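/- Let $b:\mathbb{R}\to[0,\infty)$ be a smooth function with $\|b\|_{L^1}=\int_{-\infty}^{\infty} b(s)\,ds<\infty$ and $b\in L^2(\mathbb{R})$. Let $W^{2,2}(\mathbb{R})$ be the Sobolev space of (almost-everywhere classes of) functions $\rho\in L^2(\mathbb{R})$ whose first and second weak derivatives exist and lie in $L^2(\mathbb{R})$. Then there is exactly one $\rho\in W^{2,2}(\mathbb{R})$ that solves $$\partial_s^2\rho = 1-e^{-\rho}-b$$ (the second weak derivative of $\rho$ equals the right-hand side almost everywhere). Moreover, every such solution has a continuous representative, and this representative satisfies $$0\le \rho(s)\le \max\big\{2\ln 2,\;4\|b\|_{L^1}^2\big\}\qquad\text{for every } s\in\mathbb{R}.$$ -/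

import Mathlib

open MeasureTheory
open scoped ContDiff

/-- `g` is a weak (distributional) derivative of `f` on the real line: both are locally
integrable, and `∫ f φ' = - ∫ g φ` for every smooth compactly supported test function `φ`. -/
def IsWeakDeriv (f g : ℝ → ℝ) : Prop :=
  LocallyIntegrable f volume ∧ LocallyIntegrable g volume ∧
    ∀ φ : ℝ → ℝ, ContDiff ℝ ∞ φ → HasCompactSupport φ →
      ∫ s, f s * deriv φ s = - ∫ s, g s * φ s

/-- The Sobolev space `W^{2,2}(ℝ)`: the classes `ρ ∈ L²(ℝ)` (modulo equality almost everywhere)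
whose first and second weak derivatives exist and lie in `L²(ℝ)`. -/
def SobolevW22 : Set (Lp ℝ 2 (volume : Measure ℝ)) :=
  {ρ | ∃ ρ₁ ρ₂ : Lp ℝ 2 (volume : Measure ℝ), IsWeakDeriv ρ ρ₁ ∧ IsWeakDeriv ρ₁ ρ₂}

/-- The equation `∂²ρ = 1 - e^{-ρ} - b` for `ρ ∈ L²(ℝ)`: the second weak derivative of `ρ`
exists and equals the right-hand side almost everywhere. -/
def SolvesKazdanWarner (b : ℝ → ℝ) (ρ : Lp ℝ 2 (volume : Measure ℝ)) : Prop :=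
  ∃ ρ₁ ρ₂ : ℝ → ℝ, IsWeakDeriv ρ ρ₁ ∧ IsWeakDeriv ρ₁ ρ₂ ∧
    ∀ᵐ s, ρ₂ s = 1 - Real.exp (-(ρ s)) - b s

open Set Filter Topology

/-! Since `x ↦ 1 - e^{-x}` is increasing, a maximum principle allows at most one classical solution
vanishing at infinity, and `b ≥ 0` makes it nonnegative. For the upper bound, put `B = ‖b‖₁`: to the
right of a maximum the slope never drops below `-B`, so a maximum that is too high keeps `r ≥ ln 2`
on an interval longer than `2B`. There `1 - e^{-r} ≥ 1/2`, which outweighs `b`; the slope then stays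
positive and `r` outgrows its maximum (`le_max_of_hasDerivAt_of_le_half`).

For existence, write the equation as `r - r'' = F(r) + b` with `F(x) = x - 1 + e^{-x}`. The inverse
of `1 - ∂²` is convolution with `e^{-|t|}/2`, of mass one, and `F` has slope at most `1 - e^{-M} <
1` on `[0, M]`. With `F` frozen outside `[0, M]`, Banach's theorem applies in `C₀(ℝ)`. The a priori
bounds also hold for the frozen equation, so the freezing is never felt.

Weak solutions in `W^{2,2}` are classical and decay, by du Bois-Reymond and a bootstrap; conversely,
integrating the equation, alone and against `r`, puts the classical solution in `W^{2,2}`. -/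

/-! ### Weak derivatives on the line -/

theorem HasCompactSupport.exists_tsupport_subset_Ioo {φ : ℝ → ℝ} (hφ : HasCompactSupport φ) :
    ∃ R : ℝ, 0 < R ∧ tsupport φ ⊆ Ioo (-R) R := by
  obtain ⟨R, hR⟩ := hφ.isCompact.isBounded.subset_closedBall 0
  refine ⟨|R| + 1, by positivity, fun x hx => ?_⟩
  have := hR hx
  rw [Metric.mem_closedBall, dist_zero_right, Real.norm_eq_abs] at this
  have h2 := abs_le.1 (this.trans (le_abs_self R))
  constructor <;> linarith [h2.1, h2.2]

theorem MeasureTheory.LocallyIntegrable.intervalIntegrable' {g : ℝ → ℝ} (hg : LocallyIntegrable g volume)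
    (a b : ℝ) : IntervalIntegrable g volume a b :=
  intervalIntegrable_iff.mpr <|
    (hg.integrableOn_isCompact isCompact_uIcc).mono_set uIoc_subset_uIcc

/-- The primitive is absolutely continuous with derivative `g` almost everywhere, so integration by
parts applies; the boundary terms vanish with `φ`. -/
theorem integral_primitive_mul_deriv {g : ℝ → ℝ} (hg : LocallyIntegrable g volume)
    {φ : ℝ → ℝ} (hφ : ContDiff ℝ ∞ φ) (hc : HasCompactSupport φ) :
    ∫ s, (∫ t in (0:ℝ)..s, g t) * deriv φ s = - ∫ s, g s * φ s := by
  obtain ⟨R, hR, hsub⟩ := hc.exists_tsupport_subset_Ioo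
  have hle : -R ≤ R := by linarith
  have hgi : ∀ a b, IntervalIntegrable g volume a b := fun a b => LocallyIntegrable.intervalIntegrable' hg a b
  have hφ0 : ∀ x, x ∉ Ioo (-R) R → φ x = 0 := fun x hx => image_eq_zero_of_notMem_tsupport
    fun h => hx (hsub h)
  have hsupp : Function.support φ ⊆ Ioc (-R) R :=
    (subset_tsupport φ).trans (hsub.trans Ioo_subset_Ioc_self)
  have hsupp' : Function.support (deriv φ) ⊆ Ioc (-R) R :=
    support_deriv_subset.trans (hsub.trans Ioo_subset_Ioc_self)
  have e1 : ∫ s, (∫ t in (0:ℝ)..s, g t) * deriv φ s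
      = ∫ s in (-R)..R, (∫ t in (0:ℝ)..s, g t) * deriv φ s :=
    (intervalIntegral.integral_eq_integral_of_support_subset
      ((Function.support_mul_subset_right _ _).trans hsupp')).symm
  have e2 : ∫ s, g s * φ s = ∫ s in (-R)..R, g s * φ s :=
    (intervalIntegral.integral_eq_integral_of_support_subset
      ((Function.support_mul_subset_right _ _).trans hsupp)).symm
  have hac : AbsolutelyContinuousOnInterval (fun s => ∫ t in (0:ℝ)..s, g t) (-R) R :=
    (hgi (-R) R).absolutelyContinuousOnInterval_intervalIntegral
      (by rw [uIcc_of_le hle]; constructor <;> linarith)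
  have hφac : AbsolutelyContinuousOnInterval φ (-R) R :=
    (hφ.of_le (by simp)).contDiffOn.absolutelyContinuousOnInterval
  rw [e1, e2, hac.integral_mul_deriv_eq_deriv_mul hφac, hφ0 R (by simp), hφ0 (-R) (by simp)]
  have : ∫ s in (-R)..R, deriv (fun s => ∫ t in (0:ℝ)..s, g t) s * φ s
      = ∫ s in (-R)..R, g s * φ s := by
    apply intervalIntegral.integral_congr_ae
    filter_upwards [(hgi (-R) R).ae_hasDerivAt_integral] with x hx hx2
    rw [(hx (uIoc_subset_uIcc hx2) 0 (by rw [uIcc_of_le hle]; constructor <;> linarith)).deriv]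
  rw [this]; ring

theorem MeasureTheory.LocallyIntegrable.integrable_mul_test {f : ℝ → ℝ} (hf : LocallyIntegrable f volume)
    {φ : ℝ → ℝ} (hφ : Continuous φ) (hc : HasCompactSupport φ) :
    Integrable (fun s => f s * φ s) volume := by
  simpa [smul_eq_mul, mul_comm] using hf.integrable_smul_left_of_hasCompactSupport hφ hc

theorem exists_test_primitive {ψ : ℝ → ℝ} (hψ : ContDiff ℝ ∞ ψ) (hc : HasCompactSupport ψ)
    (h0 : ∫ s, ψ s = 0) :
    ∃ φ : ℝ → ℝ, ContDiff ℝ ∞ φ ∧ HasCompactSupport φ ∧ deriv φ = ψ := by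
  obtain ⟨R, hR, hsub⟩ := hc.exists_tsupport_subset_Ioo
  have hsupp : Function.support ψ ⊆ Ioo (-R) R := (subset_tsupport ψ).trans hsub
  have hψ0 : ∀ x, x ∉ Ioo (-R) R → ψ x = 0 := fun x hx => by
    by_contra h; exact hx (hsupp h)
  have hd : ∀ x, HasDerivAt (fun x => ∫ t in (-R)..x, ψ t) (ψ x) x := fun x =>
    intervalIntegral.integral_hasDerivAt_right (hψ.continuous.intervalIntegrable _ _)
      (hψ.continuous.stronglyMeasurableAtFilter _ _) hψ.continuous.continuousAt
  have hderiv : deriv (fun x => ∫ t in (-R)..x, ψ t) = ψ := funext fun x => (hd x).deriv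
  refine ⟨fun x => ∫ t in (-R)..x, ψ t, ?_, ?_, hderiv⟩
  · rw [contDiff_infty_iff_deriv, hderiv]
    exact ⟨fun x => (hd x).differentiableAt, hψ⟩
  · refine HasCompactSupport.intro (isCompact_Icc (a := -R) (b := R)) fun x hx => ?_
    rw [mem_Icc, not_and_or, not_le, not_le] at hx
    rcases hx with hx | hx
    · rw [intervalIntegral.integral_zero_ae]
      refine Eventually.of_forall fun t ht => hψ0 t ?_
      rw [uIoc_of_ge hx.le] at ht
      exact fun h => absurd ht.2 (not_le.2 h.1)
    · rw [intervalIntegral.integral_eq_integral_of_support_subset, h0]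
      exact hsupp.trans fun y hy => ⟨hy.1, hy.2.le.trans hx.le⟩

/-- Du Bois-Reymond: for a fixed bump `χ` of mass one, `ψ - (∫ ψ) χ` has mean zero and is thus the
derivative of a test function. Hence `∫ f ψ = c ∫ ψ` with `c = ∫ f χ`. -/
theorem ae_eq_const_of_integral_mul_deriv_eq_zero {f : ℝ → ℝ} (hf : LocallyIntegrable f volume)
    (h : ∀ φ : ℝ → ℝ, ContDiff ℝ ∞ φ → HasCompactSupport φ → ∫ s, f s * deriv φ s = 0) :
    ∃ c : ℝ, ∀ᵐ s, f s = c := by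
  let χ₀ : ContDiffBump (0:ℝ) := ⟨1, 2, by norm_num, by norm_num⟩
  let χ : ℝ → ℝ := χ₀.normed volume
  have hχ : ContDiff ℝ ∞ χ := χ₀.contDiff_normed
  have hχc : HasCompactSupport χ := χ₀.hasCompactSupport_normed
  have hχ1 : ∫ s, χ s = 1 := χ₀.integral_normed
  set c := ∫ s, f s * χ s with hcdef
  refine ⟨c, ?_⟩
  have key : ∀ᵐ s, f s - c = 0 := by
    refine ae_eq_zero_of_integral_contDiff_smul_eq_zero
      (hf.sub (locallyIntegrable_const c)) fun ψ hψ hψc => ?_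
    set m := ∫ s, ψ s with hm
    have hψi : Integrable ψ volume := hψ.continuous.integrable_of_hasCompactSupport hψc
    have hχi : Integrable χ volume := hχ.continuous.integrable_of_hasCompactSupport hχc
    have hmχ : HasCompactSupport (fun s => m * χ s) := hχc.mul_left
    obtain ⟨φ, hφ, hφc, hφd⟩ := exists_test_primitive (ψ := fun s => ψ s - m * χ s)
      (hψ.sub (contDiff_const.mul hχ)) (hψc.sub hmχ)
      (by rw [integral_sub hψi (hχi.const_mul m), integral_const_mul, hχ1, ← hm]; ring)
    have h0 := h φ hφ hφc
    rw [hφd] at h0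
    have i1 := LocallyIntegrable.integrable_mul_test hf hψ.continuous hψc
    have i2 := LocallyIntegrable.integrable_mul_test hf hχ.continuous hχc
    have e1 : ∫ s, f s * (ψ s - m * χ s) = (∫ s, f s * ψ s) - m * c := by
      rw [hcdef, ← integral_const_mul, ← integral_sub i1 (i2.const_mul m)]
      congr 1; ext s; ring
    have e2 : ∫ s, ψ s • (f s - c) = (∫ s, f s * ψ s) - m * c := by
      rw [hm, ← integral_mul_const, ← integral_sub i1 (hψi.mul_const c)]
      congr 1; ext s; simp only [smul_eq_mul]; ring
    rw [← h0, e1]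
    exact e2
  filter_upwards [key] with s hs
  linarith

/-- A function with a weak derivative is, up to a constant, a primitive of it. -/
theorem IsWeakDeriv.exists_ae_eq_primitive {f g : ℝ → ℝ} (h : IsWeakDeriv f g) :
    ∃ c : ℝ, ∀ᵐ s, f s = c + ∫ t in (0:ℝ)..s, g t := by
  obtain ⟨hf, hg, hw⟩ := h
  have hcont : Continuous fun s => ∫ t in (0:ℝ)..s, g t :=
    intervalIntegral.continuous_primitive (fun a b => LocallyIntegrable.intervalIntegrable' hg a b) 0
  have hpl : LocallyIntegrable (fun s => ∫ t in (0:ℝ)..s, g t) volume := hcont.locallyIntegrable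
  obtain ⟨c, hc⟩ := ae_eq_const_of_integral_mul_deriv_eq_zero (hf.sub hpl) (by
    intro φ hφ hφc
    have hdc : HasCompactSupport (deriv φ) := hφc.deriv
    have hdcont : Continuous (deriv φ) := hφ.continuous_deriv (by simp)
    have i1 := LocallyIntegrable.integrable_mul_test hf hdcont hdc
    have i2 := LocallyIntegrable.integrable_mul_test hpl hdcont hdc
    simp only [Pi.sub_apply, sub_mul]
    rw [integral_sub i1 i2, hw φ hφ hφc, integral_primitive_mul_deriv hg hφ hφc, sub_self])
  refine ⟨c, ?_⟩
  filter_upwards [hc] with s hs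
  simp only [Pi.sub_apply] at hs
  linarith

theorem isWeakDeriv_of_hasDerivAt {f g : ℝ → ℝ} (hf : ∀ s, HasDerivAt f (g s) s)
    (hg : Continuous g) : IsWeakDeriv f g := by
  have hfc : Continuous f := continuous_iff_continuousAt.2 fun s => (hf s).continuousAt
  refine ⟨hfc.locallyIntegrable, hg.locallyIntegrable, fun φ hφ hφc => ?_⟩
  have hdc : HasCompactSupport (deriv φ) := hφc.deriv
  have hdcont : Continuous (deriv φ) := hφ.continuous_deriv (by simp)
  exact integral_mul_deriv_eq_deriv_mul_of_integrable (fun x _ => hf x)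
    (fun x _ => (hφ.differentiable (by simp) x).hasDerivAt)
    (LocallyIntegrable.integrable_mul_test hfc.locallyIntegrable hdcont hdc)
    (LocallyIntegrable.integrable_mul_test hg.locallyIntegrable hφ.continuous hφc)
    (LocallyIntegrable.integrable_mul_test hfc.locallyIntegrable hφ.continuous hφc)

theorem IsWeakDeriv.congr_ae {f g f' g' : ℝ → ℝ} (h : IsWeakDeriv f g) (hf : f =ᵐ[volume] f')
    (hg : g =ᵐ[volume] g') : IsWeakDeriv f' g' := by
  refine ⟨fun x => (h.1 x).congr hf, fun x => (h.2.1 x).congr hg, fun φ hφ hφc => ?_⟩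
  have e1 : ∫ s, f' s * deriv φ s = ∫ s, f s * deriv φ s :=
    integral_congr_ae (hf.mono fun s hs => by simp only [hs])
  have e2 : ∫ s, g' s * φ s = ∫ s, g s * φ s :=
    integral_congr_ae (hg.mono fun s hs => by simp only [hs])
  rw [e1, e2, h.2.2 φ hφ hφc]

/-! ### A priori bounds for decaying classical solutions -/

/-- Weak maximum principle on the line for functions vanishing at infinity. -/
theorem nonneg_of_tendsto_cocompact_of_deriv2_neg {r r₁ r₂ : ℝ → ℝ}
    (h₁ : ∀ s, HasDerivAt r (r₁ s) s) (h₂ : ∀ s, HasDerivAt r₁ (r₂ s) s)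
    (h0 : Tendsto r (cocompact ℝ) (𝓝 0)) (hneg : ∀ s, r s < 0 → r₂ s < 0) (s : ℝ) : 0 ≤ r s := by
  by_contra! hs
  have hc : Continuous r := continuous_iff_continuousAt.2 fun s => (h₁ s).continuousAt
  obtain ⟨s₀, hs₀⟩ := hc.exists_forall_le' s ((h0.eventually (lt_mem_nhds hs)).mono fun x hx => hx.le)
  have hd : deriv r = r₁ := funext fun x => (h₁ x).deriv
  have hmin : IsLocalMin r s₀ := Eventually.of_forall hs₀
  have hr0 : r₁ s₀ = 0 := hmin.hasDerivAt_eq_zero (h₁ s₀)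
  have hr2 : r₂ s₀ < 0 := hneg s₀ ((hs₀ s).trans_lt hs)
  -- The second derivative test makes the minimum a local maximum too, so `r` is locally constant
  -- there and `r₂ s₀ = 0`.
  have hmax : IsLocalMax r s₀ := isLocalMax_of_deriv_deriv_neg
    (by rw [hd, (h₂ s₀).deriv]; exact hr2) (by rw [hd, hr0]) hc.continuousAt
  have hconst : r =ᶠ[𝓝 s₀] fun _ => r s₀ := by
    filter_upwards [hmax] with x hx using le_antisymm hx (hs₀ x)
  have h3 := hconst.deriv.deriv_eq
  rw [hd, (h₂ s₀).deriv] at h3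
  simp at h3
  exact hr2.ne h3

theorem intervalIntegral_le_integral {b : ℝ → ℝ} (hb0 : ∀ s, 0 ≤ b s)
    (hb : Integrable b volume) {x y : ℝ} (hxy : x ≤ y) : ∫ t in x..y, b t ≤ ∫ t, b t := by
  rw [intervalIntegral.integral_of_le hxy]
  exact setIntegral_le_integral hb (Eventually.of_forall hb0)

/-- The term `h` is left abstract so that the bound serves both `1 - e^{-r}` and its truncated
version. -/
theorem le_max_of_hasDerivAt_of_le_half {r r₁ h b : ℝ → ℝ}
    (h₁ : ∀ s, HasDerivAt r (r₁ s) s) (h₂ : ∀ s, HasDerivAt r₁ (h s - b s) s)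
    (h0 : Tendsto r (cocompact ℝ) (𝓝 0)) (hr : ∀ s, 0 ≤ r s)
    (hhc : Continuous h) (hbc : Continuous b) (hb0 : ∀ s, 0 ≤ b s) (hb : Integrable b volume)
    (hh0 : ∀ s, 0 ≤ h s) (hh : ∀ s, Real.log 2 ≤ r s → 1 / 2 ≤ h s) (s : ℝ) :
    r s ≤ max (2 * Real.log 2) (4 * (∫ σ, b σ) ^ 2) := by
  by_contra! hs
  have hlog : 0 < Real.log 2 := Real.log_pos (by norm_num)
  have hpos : 0 < r s := lt_of_le_of_lt ((by positivity : 0 ≤ 2 * Real.log 2).trans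
    (le_max_left _ _)) hs
  have hc : Continuous r := continuous_iff_continuousAt.2 fun s => (h₁ s).continuousAt
  obtain ⟨s₀, hs₀⟩ := hc.exists_forall_ge' s ((h0.eventually_lt_const hpos).mono fun x hx => hx.le)
  set B := ∫ σ, b σ with hB
  have hB0 : 0 ≤ B := integral_nonneg hb0
  set M := r s₀ with hM
  have hM1 : 2 * Real.log 2 < M := (le_max_left _ _).trans_lt (hs.trans_le (hs₀ s))
  have hM2 : 4 * B ^ 2 < M := (le_max_right _ _).trans_lt (hs.trans_le (hs₀ s))
  have hmax : IsLocalMax r s₀ := Eventually.of_forall hs₀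
  have hr0 : r₁ s₀ = 0 := hmax.hasDerivAt_eq_zero (h₁ s₀)
  have hftc : ∀ x y, r₁ y - r₁ x = (∫ t in x..y, h t) - ∫ t in x..y, b t := fun x y => by
    rw [← intervalIntegral.integral_sub (hhc.intervalIntegrable _ _) (hbc.intervalIntegrable _ _)]
    exact (intervalIntegral.integral_eq_sub_of_hasDerivAt (fun x _ => h₂ x)
      ((hhc.sub hbc).intervalIntegrable _ _)).symm
  have hlow : ∀ x, s₀ ≤ x → -B ≤ r₁ x := fun x hx => by
    have e := hftc s₀ x
    have e1 := intervalIntegral_le_integral hb0 hb hx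
    have e2 : 0 ≤ ∫ t in s₀..x, h t := intervalIntegral.integral_nonneg hx fun t _ => hh0 t
    linarith
  have hmvt : ∀ c x y : ℝ, x ≤ y → (∀ z, x ≤ z → c ≤ r₁ z) → c * (y - x) ≤ r y - r x := by
    intro c x y hxy hz
    refine (convex_Ici x).mul_sub_le_image_sub_of_le_deriv hc.continuousOn
      (fun z _ => (h₁ z).differentiableAt.differentiableWithinAt) (fun z hz' => ?_)
      x self_mem_Ici y hxy hxy
    rw [(h₁ z).deriv]
    exact hz z (interior_subset hz')
  -- Chosen so that `B * L + δ = M / 2` for `L = 2 * B + δ`: descending from `M` with slope at least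
  -- `-B` over length `L` leaves `r ≥ M / 2 + δ > log 2`, while `L / 2` exceeds `B` by `δ / 2`. The
  -- `+ 1` avoids dividing by zero when `B = 0`.
  set δ := (M / 2 - 2 * B ^ 2) / (B + 1) with hδ
  have hδ0 : 0 < δ := div_pos (by linarith) (by linarith)
  have hδB : δ * (B + 1) = M / 2 - 2 * B ^ 2 := div_mul_cancel₀ _ (by linarith)
  set L := 2 * B + δ with hL
  have hL0 : 0 ≤ L := by linarith
  have hhalf : ∀ x ∈ Icc s₀ (s₀ + L), 1 / 2 ≤ h x := fun x hx => hh x <| by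
    have h3 := hmvt (-B) s₀ x hx.1 hlow
    have h4 : B * (x - s₀) ≤ B * L := mul_le_mul_of_nonneg_left (by linarith [hx.2]) hB0
    have h5 : B * L = 2 * B ^ 2 + (δ * (B + 1) - δ) := by rw [hL]; ring
    linarith
  have hhint : ∀ y, s₀ + L ≤ y → L / 2 ≤ ∫ t in s₀..y, h t := fun y hy => by
    have e1 : ∫ t in s₀..(s₀ + L), (1 / 2 : ℝ) ≤ ∫ t in s₀..(s₀ + L), h t :=
      intervalIntegral.integral_mono_on (by linarith) (by simp) (hhc.intervalIntegrable _ _) hhalf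
    have e2 : 0 ≤ ∫ t in (s₀ + L)..y, h t := intervalIntegral.integral_nonneg hy fun t _ => hh0 t
    rw [← intervalIntegral.integral_add_adjacent_intervals (hhc.intervalIntegrable s₀ (s₀ + L))
      (hhc.intervalIntegrable _ y)]
    rw [intervalIntegral.integral_const, smul_eq_mul] at e1
    linarith
  have hup : ∀ y, s₀ + L ≤ y → δ / 2 ≤ r₁ y := fun y hy => by
    have e := hftc s₀ y
    have e1 := intervalIntegral_le_integral hb0 hb (by linarith : s₀ ≤ y)
    have e2 := hhint y hy
    linarith
  have hT : 0 ≤ (M + 1) * 2 / δ := div_nonneg (by linarith) hδ0.le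
  have h6 := hmvt (δ / 2) (s₀ + L) (s₀ + L + (M + 1) * 2 / δ) (by linarith) hup
  have h7 : δ / 2 * (s₀ + L + (M + 1) * 2 / δ - (s₀ + L)) = M + 1 := by field_simp; ring
  have h8 := hs₀ (s₀ + L + (M + 1) * 2 / δ)
  have h9 := hr (s₀ + L)
  linarith

/-! ### Regularity, decay and uniqueness -/

theorem IsWeakDeriv.unique_ae {f g g' : ℝ → ℝ} (h : IsWeakDeriv f g) (h' : IsWeakDeriv f g') :
    g =ᵐ[volume] g' := by
  refine ae_eq_of_integral_contDiff_smul_eq h.2.1 h'.2.1 fun φ hφ hφc => ?_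
  have e := (h.2.2 φ hφ hφc).symm.trans (h'.2.2 φ hφ hφc)
  simp only [smul_eq_mul]
  simp only [mul_comm (φ _)]
  linarith

/-- Both `r²` and its derivative `2 r r₁` are integrable, so `r²` tends to zero at both ends. -/
theorem tendsto_cocompact_of_memLp_two_of_hasDerivAt {r r₁ : ℝ → ℝ}
    (h₁ : ∀ s, HasDerivAt r (r₁ s) s) (hr : MemLp r 2 volume) (hr₁ : MemLp r₁ 2 volume) :
    Tendsto r (cocompact ℝ) (𝓝 0) := by
  have hd : ∀ s, HasDerivAt (fun s => r s * r s) (r₁ s * r s + r s * r₁ s) s :=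
    fun s => (h₁ s).mul (h₁ s)
  have i1 : Integrable (fun s => r s * r s) volume := hr.integrable_mul hr
  have i2 : Integrable (fun s => r₁ s * r s + r s * r₁ s) volume :=
    (hr₁.integrable_mul hr).add (hr.integrable_mul hr₁)
  have h2 : Tendsto (fun s => r s * r s) (cocompact ℝ) (𝓝 0) := by
    rw [cocompact_eq_atBot_atTop, tendsto_sup]
    exact ⟨tendsto_zero_of_hasDerivAt_of_integrableOn_Iic (a := 0) (fun s _ => hd s)
        i2.integrableOn i1.integrableOn,
      tendsto_zero_of_hasDerivAt_of_integrableOn_Ioi (a := 0) (fun s _ => hd s)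
        i2.integrableOn i1.integrableOn⟩
  have h3 := h2.sqrt
  rw [Real.sqrt_zero] at h3
  simp only [Real.sqrt_mul_self_eq_abs] at h3
  exact (tendsto_zero_iff_abs_tendsto_zero _).2 h3

/-- Regularity and decay of `W^{2,2}` solutions. -/
theorem SolvesKazdanWarner.exists_classical {b : ℝ → ℝ} (hbc : Continuous b)
    {ρ : Lp ℝ 2 (volume : Measure ℝ)} (hρ : ρ ∈ SobolevW22) (h : SolvesKazdanWarner b ρ) :
    ∃ r r₁ : ℝ → ℝ, (∀ᵐ s, ρ s = r s) ∧ (∀ s, HasDerivAt r (r₁ s) s) ∧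
      (∀ s, HasDerivAt r₁ (1 - Real.exp (-(r s)) - b s) s) ∧
      Tendsto r (cocompact ℝ) (𝓝 0) := by
  obtain ⟨ρ₁, ρ₂, hw₁, hw₂, heq⟩ := h
  obtain ⟨c₀, hc₀⟩ := hw₁.exists_ae_eq_primitive
  obtain ⟨c₁, hc₁⟩ := hw₂.exists_ae_eq_primitive
  -- Bootstrap: `r` is continuous, hence so is `k`; its primitive `r₁` is then `C¹`, and `r`, a
  -- primitive of `ρ₁ = r₁` a.e., is `C²`.
  set r : ℝ → ℝ := fun s => c₀ + ∫ t in (0:ℝ)..s, ρ₁ t with hr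
  have hrc : Continuous r := continuous_const.add
    (intervalIntegral.continuous_primitive
      (fun a b => LocallyIntegrable.intervalIntegrable' hw₁.2.1 a b) 0)
  set k : ℝ → ℝ := fun s => 1 - Real.exp (-(r s)) - b s with hk
  have hkc : Continuous k := by fun_prop
  have hρ₂ : ρ₂ =ᵐ[volume] k := by
    filter_upwards [heq, hc₀] with s h1 h2
    rw [h1, h2]
  set r₁ : ℝ → ℝ := fun s => c₁ + ∫ t in (0:ℝ)..s, k t with hr₁
  have hρ₁ : ρ₁ =ᵐ[volume] r₁ := by
    filter_upwards [hc₁] with s hs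
    rw [hs, hr₁]
    simp only
    rw [intervalIntegral.integral_congr_ae (hρ₂.mono fun x hx _ => hx)]
  have hd₁ : ∀ s, HasDerivAt r₁ (k s) s := fun s =>
    (intervalIntegral.integral_hasDerivAt_right (hkc.intervalIntegrable _ _)
      (hkc.stronglyMeasurableAtFilter _ _) hkc.continuousAt).const_add c₁
  have hr₁c : Continuous r₁ := continuous_iff_continuousAt.2 fun s => (hd₁ s).continuousAt
  have hre : r = fun s => c₀ + ∫ t in (0:ℝ)..s, r₁ t := funext fun s => by
    rw [hr]
    simp only
    rw [intervalIntegral.integral_congr_ae (hρ₁.mono fun x hx _ => hx)]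
  have hd : ∀ s, HasDerivAt r (r₁ s) s := fun s => by
    rw [hre]
    exact (intervalIntegral.integral_hasDerivAt_right (hr₁c.intervalIntegrable _ _)
      (hr₁c.stronglyMeasurableAtFilter _ _) hr₁c.continuousAt).const_add c₀
  refine ⟨r, r₁, hc₀, hd, hd₁, ?_⟩
  -- The derivative `ρ₁` from the equation is only known to be locally integrable; membership in
  -- `W^{2,2}` supplies the `L²` bound needed for decay.
  obtain ⟨σ₁, σ₂, hv₁, hv₂⟩ := hρ
  have hσ : (σ₁ : ℝ → ℝ) =ᵐ[volume] r₁ := (hv₁.unique_ae hw₁).trans hρ₁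
  exact tendsto_cocompact_of_memLp_two_of_hasDerivAt hd
    ((memLp_congr_ae hc₀).1 (Lp.memLp ρ)) ((memLp_congr_ae hσ).1 (Lp.memLp σ₁))

theorem classical_solution_unique {b r r₁ q q₁ : ℝ → ℝ}
    (hr : ∀ s, HasDerivAt r (r₁ s) s)
    (hr₁ : ∀ s, HasDerivAt r₁ (1 - Real.exp (-(r s)) - b s) s)
    (hr0 : Tendsto r (cocompact ℝ) (𝓝 0))
    (hq : ∀ s, HasDerivAt q (q₁ s) s)
    (hq₁ : ∀ s, HasDerivAt q₁ (1 - Real.exp (-(q s)) - b s) s)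
    (hq0 : Tendsto q (cocompact ℝ) (𝓝 0)) : r = q := by
  have key : ∀ {r r₁ q q₁ : ℝ → ℝ}, (∀ s, HasDerivAt r (r₁ s) s) →
      (∀ s, HasDerivAt r₁ (1 - Real.exp (-(r s)) - b s) s) → Tendsto r (cocompact ℝ) (𝓝 0) →
      (∀ s, HasDerivAt q (q₁ s) s) → (∀ s, HasDerivAt q₁ (1 - Real.exp (-(q s)) - b s) s) →
      Tendsto q (cocompact ℝ) (𝓝 0) → ∀ s, q s ≤ r s := by
    intro r r₁ q q₁ hr hr₁ hr0 hq hq₁ hq0 s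
    have := nonneg_of_tendsto_cocompact_of_deriv2_neg (fun s => (hr s).sub (hq s))
      (fun s => (hr₁ s).sub (hq₁ s)) (by have h := hr0.sub hq0; rwa [sub_zero] at h) (fun s hs => by
        simp only [Pi.sub_apply] at hs
        have : Real.exp (-(q s)) < Real.exp (-(r s)) := Real.exp_lt_exp.2 (by linarith)
        linarith) s
    simp only [Pi.sub_apply] at this
    linarith
  exact funext fun s => le_antisymm (key hq hq₁ hq0 hr hr₁ hr0 s) (key hr hr₁ hr0 hq hq₁ hq0 s)

theorem classical_solution_bounds {b r r₁ : ℝ → ℝ} (hbc : Continuous b) (hb0 : ∀ s, 0 ≤ b s)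
    (hb : Integrable b volume) (hr : ∀ s, HasDerivAt r (r₁ s) s)
    (hr₁ : ∀ s, HasDerivAt r₁ (1 - Real.exp (-(r s)) - b s) s)
    (hr0 : Tendsto r (cocompact ℝ) (𝓝 0)) (s : ℝ) :
    0 ≤ r s ∧ r s ≤ max (2 * Real.log 2) (4 * (∫ σ, b σ) ^ 2) := by
  have hc : Continuous r := continuous_iff_continuousAt.2 fun s => (hr s).continuousAt
  have hnn := nonneg_of_tendsto_cocompact_of_deriv2_neg hr hr₁ hr0 fun s hs => by
    have : 1 < Real.exp (-(r s)) := Real.one_lt_exp_iff.2 (by linarith)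
    linarith [hb0 s]
  refine ⟨hnn s, le_max_of_hasDerivAt_of_le_half (h := fun s => 1 - Real.exp (-(r s)))
    hr hr₁ hr0 hnn (by fun_prop) hbc hb0 hb (fun s => ?_) (fun s hs => ?_) s⟩
  · have : Real.exp (-(r s)) ≤ 1 := Real.exp_le_one_iff.2 (by linarith [hnn s])
    linarith
  · have : Real.exp (-(r s)) ≤ Real.exp (-Real.log 2) := Real.exp_le_exp.2 (by linarith)
    rw [Real.exp_neg (Real.log 2), Real.exp_log (by norm_num)] at this
    linarith

/-! ### The Green operator of `1 - ∂²` -/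

/-- Dominated convergence along a filter requires it to be countably generated. -/
instance isCountablyGenerated_cocompact_real : (cocompact ℝ).IsCountablyGenerated := by
  rw [cocompact_eq_atBot_atTop]; infer_instance

/-- Functions admissible for the left half of the Green operator of `1 - ∂²`. -/
def ExpIntegrable (f : ℝ → ℝ) : Prop :=
  Continuous f ∧ ∀ s, IntegrableOn (fun t => Real.exp t * f t) (Iic s) volume

/-- The convolution of `f` with `e^{-t}` on the positive half line. -/
noncomputable def expLeft (f : ℝ → ℝ) (s : ℝ) : ℝ :=
  Real.exp (-s) * ∫ t in Iic s, Real.exp t * f t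

theorem ExpIntegrable.of_bounded {f : ℝ → ℝ} (hf : Continuous f) {C : ℝ} (hC : ∀ s, |f s| ≤ C) :
    ExpIntegrable f :=
  ⟨hf, fun s => (integrableOn_exp_Iic s).mul_bdd hf.aestronglyMeasurable
    (Eventually.of_forall hC)⟩

/-- Needed for `b`, which may be unbounded; the bounded criterion serves `F(r)`. -/
theorem ExpIntegrable.of_integrable {f : ℝ → ℝ} (hf : Continuous f) (hi : Integrable f volume) :
    ExpIntegrable f := by
  refine ⟨hf, fun s => hi.integrableOn.bdd_mul (c := Real.exp s)
    Real.continuous_exp.aestronglyMeasurable ?_⟩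
  filter_upwards [ae_restrict_mem measurableSet_Iic] with t ht
  rw [Real.norm_eq_abs, Real.abs_exp]
  exact Real.exp_le_exp.2 ht

theorem ExpIntegrable.add {f g : ℝ → ℝ} (hf : ExpIntegrable f) (hg : ExpIntegrable g) :
    ExpIntegrable (fun s => f s + g s) :=
  ⟨hf.1.add hg.1, fun s => by simp only [mul_add]; exact (hf.2 s).add (hg.2 s)⟩

theorem expLeft_add {f g : ℝ → ℝ} (hf : ExpIntegrable f) (hg : ExpIntegrable g) (s : ℝ) :
    expLeft (fun t => f t + g t) s = expLeft f s + expLeft g s := by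
  simp only [expLeft, mul_add]
  rw [integral_add (hf.2 s) (hg.2 s), mul_add]

theorem ExpIntegrable.hasDerivAt {f : ℝ → ℝ} (hf : ExpIntegrable f) (s : ℝ) :
    HasDerivAt (expLeft f) (-expLeft f s + f s) s := by
  have hc : Continuous fun t => Real.exp t * f t := Real.continuous_exp.mul hf.1
  have e : (fun x => ∫ t in Iic x, Real.exp t * f t) = fun x =>
      (∫ t in Iic 0, Real.exp t * f t) + ∫ t in (0:ℝ)..x, Real.exp t * f t := funext fun x => by
    rw [← intervalIntegral.integral_Iic_sub_Iic (hf.2 0) (hf.2 x)]; ring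
  have h1 : HasDerivAt (fun x => ∫ t in Iic x, Real.exp t * f t) (Real.exp s * f s) s := by
    rw [e]
    exact (intervalIntegral.integral_hasDerivAt_right (hc.intervalIntegrable _ _)
      (hc.stronglyMeasurableAtFilter _ _) hc.continuousAt).const_add _
  have h2 : HasDerivAt (fun x => Real.exp (-x)) (-Real.exp (-s)) s := by
    simpa using (hasDerivAt_neg s).exp
  have h3 := h2.mul h1
  have e2 : Real.exp (-s) * (Real.exp s * f s) = f s := by
    rw [← mul_assoc, ← Real.exp_add]; simp
  rw [e2] at h3
  have e3 : -Real.exp (-s) * (∫ t in Iic s, Real.exp t * f t) = -expLeft f s := by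
    rw [expLeft]; ring
  rw [e3] at h3
  exact h3

/-- The one-sided kernel has mass one. -/
theorem abs_expLeft_sub_le {f g : ℝ → ℝ} (hf : ExpIntegrable f) (hg : ExpIntegrable g) {C : ℝ}
    (hC : ∀ s, |f s - g s| ≤ C) (s : ℝ) : |expLeft f s - expLeft g s| ≤ C := by
  have e : expLeft f s - expLeft g s
      = Real.exp (-s) * ∫ t in Iic s, Real.exp t * (f t - g t) := by
    simp only [expLeft, mul_sub]
    rw [integral_sub (hf.2 s) (hg.2 s), mul_sub]
  have h1 : ‖∫ t in Iic s, Real.exp t * (f t - g t)‖ ≤ ∫ t in Iic s, Real.exp t * C := by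
    refine norm_integral_le_of_norm_le ((integrableOn_exp_Iic s).mul_const C)
      (Eventually.of_forall fun t => ?_)
    rw [norm_mul, Real.norm_eq_abs, Real.abs_exp]
    exact mul_le_mul_of_nonneg_left (hC t) (Real.exp_pos t).le
  rw [integral_mul_const, integral_exp_Iic, Real.norm_eq_abs] at h1
  rw [e, abs_mul, Real.abs_exp]
  refine (mul_le_mul_of_nonneg_left h1 (Real.exp_pos _).le).trans_eq ?_
  rw [← mul_assoc, ← Real.exp_add]; simp

theorem expLeft_eq_integral_Iic_zero (f : ℝ → ℝ) (s : ℝ) :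
    expLeft f s = ∫ t in Iic (0:ℝ), Real.exp t * f (t + s) := by
  have h := (measurePreserving_add_right volume s).setIntegral_preimage_emb
    (measurableEmbedding_addRight s) (fun t => Real.exp t * f t) (Iic s)
  rw [preimage_add_const_Iic, sub_self] at h
  rw [expLeft, ← h, ← integral_const_mul]
  congr 1; ext t
  rw [← mul_assoc, ← Real.exp_add]
  congr 2; ring

theorem tendsto_expLeft_of_tendsto {f : ℝ → ℝ} (hf : Continuous f) {C : ℝ}
    (hC : ∀ s, |f s| ≤ C) (h0 : Tendsto f (cocompact ℝ) (𝓝 0)) :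
    Tendsto (expLeft f) (cocompact ℝ) (𝓝 0) := by
  have h : Tendsto (fun s => ∫ t in Iic (0:ℝ), Real.exp t * f (t + s)) (cocompact ℝ)
      (𝓝 (∫ t in Iic (0:ℝ), (0:ℝ))) := by
    refine tendsto_integral_filter_of_dominated_convergence (fun t => Real.exp t * C)
      (Eventually.of_forall fun s => Continuous.aestronglyMeasurable (by fun_prop))
      (Eventually.of_forall fun s => Eventually.of_forall fun t => ?_)
      ((integrableOn_exp_Iic 0).mul_const C) (Eventually.of_forall fun t => ?_)
    · rw [norm_mul, Real.norm_eq_abs, Real.abs_exp]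
      exact mul_le_mul_of_nonneg_left (hC _) (Real.exp_pos t).le
    · have := (h0.comp (Homeomorph.addLeft t).isClosedEmbedding.tendsto_cocompact).const_mul
        (Real.exp t)
      rwa [mul_zero] at this
  rw [integral_zero] at h
  exact h.congr fun s => (expLeft_eq_integral_Iic_zero f s).symm

/-- The source `b` need not vanish at infinity, but `e^{t-s} ≤ 1` for `t ≤ s` gives the dominating
function `|f|`. Pointwise, `t` leaves `Iic s` as `s → -∞`, and the exponential decays as `s → ∞`. -/
theorem tendsto_expLeft_of_integrable {f : ℝ → ℝ} (hi : Integrable f volume) :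
    Tendsto (expLeft f) (cocompact ℝ) (𝓝 0) := by
  have e : ∀ s, expLeft f s = ∫ t, (Iic s).indicator (fun t => Real.exp (t - s) * f t) t := by
    intro s
    rw [integral_indicator measurableSet_Iic, expLeft, ← integral_const_mul]
    congr 1; ext t
    rw [← mul_assoc, ← Real.exp_add]
    congr 2; ring
  have h : Tendsto (fun s => ∫ t, (Iic s).indicator (fun t => Real.exp (t - s) * f t) t)
      (cocompact ℝ) (𝓝 (∫ t : ℝ, (0:ℝ))) := by
    refine tendsto_integral_filter_of_dominated_convergence (fun t => ‖f t‖)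
      (Eventually.of_forall fun s => ?_)
      (Eventually.of_forall fun s => Eventually.of_forall fun t => ?_) hi.norm
      (Eventually.of_forall fun t => ?_)
    · exact (Continuous.aestronglyMeasurable (by fun_prop)).mul hi.aestronglyMeasurable
        |>.indicator measurableSet_Iic
    · by_cases hts : t ∈ Iic s
      · rw [indicator_of_mem hts, norm_mul, Real.norm_eq_abs, Real.abs_exp]
        refine mul_le_of_le_one_left (norm_nonneg _) (Real.exp_le_one_iff.2 ?_)
        rw [mem_Iic] at hts; linarith
      · rw [indicator_of_notMem hts, norm_zero]; exact norm_nonneg _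
    · rw [cocompact_eq_atBot_atTop, tendsto_sup]
      constructor
      · refine tendsto_const_nhds.congr' ?_
        filter_upwards [eventually_lt_atBot t] with s hs
        rw [indicator_of_notMem (by simpa using hs)]
      · have h1 : Tendsto (fun s => Real.exp (t - s) * f t) atTop (𝓝 0) := by
          have h2 : Tendsto (fun s : ℝ => t - s) atTop atBot :=
            tendsto_const_nhds.add_atBot tendsto_neg_atTop_atBot
          have := (Real.tendsto_exp_atBot.comp h2).mul_const (f t)
          rwa [zero_mul] at this
        refine h1.congr' ?_
        filter_upwards [eventually_ge_atTop t] with s hs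
        rw [indicator_of_mem (mem_Iic.2 hs)]
  rw [integral_zero] at h
  exact h.congr fun s => (e s).symm

/-- Mirror image of `expLeft`. -/
noncomputable def expRight (f : ℝ → ℝ) (s : ℝ) : ℝ := expLeft (fun t => f (-t)) (-s)

theorem hasDerivAt_expRight {f : ℝ → ℝ} (hf : ExpIntegrable fun t => f (-t)) (s : ℝ) :
    HasDerivAt (expRight f) (expRight f s - f s) s := by
  have h := (hf.hasDerivAt (-s)).scomp s (hasDerivAt_neg s)
  exact h.congr_deriv (by simp only [expRight, smul_eq_mul, neg_neg]; ring)

theorem tendsto_neg_cocompact_real : Tendsto (fun s : ℝ => -s) (cocompact ℝ) (cocompact ℝ) :=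
  (Homeomorph.neg ℝ).isClosedEmbedding.tendsto_cocompact

/-! ### Existence by contraction and truncation -/

/-- A semilinear resolvent equation with contractive nonlinearity has a solution in `C₀(ℝ)`. -/
theorem exists_solution_of_lipschitz {b F : ℝ → ℝ} (hbc : Continuous b)
    (hb : Integrable b volume) {K : NNReal} (hK : K < 1) (hF : LipschitzWith K F) (hF0 : F 0 = 0) :
    ∃ r r₁ : ℝ → ℝ, (∀ s, HasDerivAt r (r₁ s) s) ∧
      (∀ s, HasDerivAt r₁ (r s - F (r s) - b s) s) ∧
      Tendsto r (cocompact ℝ) (𝓝 0) ∧ Tendsto r₁ (cocompact ℝ) (𝓝 0) := by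
  let f : ZeroAtInftyContinuousMap ℝ ℝ → ℝ → ℝ := fun r s => F (r s) + b s
  have hbd : ∀ (r : ZeroAtInftyContinuousMap ℝ ℝ) s, |F (r s)| ≤ K * ‖r‖ := fun r s => by
    have h1 := hF.dist_le_mul (r s) 0
    rw [hF0, dist_zero_right, dist_zero_right] at h1
    exact h1.trans (mul_le_mul_of_nonneg_left (r.toBCF.norm_coe_le_norm s) K.2)
  have hcF : ∀ r : ZeroAtInftyContinuousMap ℝ ℝ, Continuous fun s => F (r s) := fun r =>
    hF.continuous.comp r.continuous
  have htF : ∀ r : ZeroAtInftyContinuousMap ℝ ℝ,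
      Tendsto (fun s => F (r s)) (cocompact ℝ) (𝓝 0) := fun r => by
    have := (hF.continuous.tendsto 0).comp r.zero_at_infty'
    rwa [hF0] at this
  have hbn : Integrable (fun s => b (-s)) volume := hb.comp_neg
  have hL1 : ∀ r : ZeroAtInftyContinuousMap ℝ ℝ, ExpIntegrable fun s => F (r s) := fun r =>
    .of_bounded (hcF r) (hbd r)
  have hL2 : ExpIntegrable b := .of_integrable hbc hb
  have hL : ∀ r, ExpIntegrable (f r) := fun r => (hL1 r).add hL2
  have hR1 : ∀ r : ZeroAtInftyContinuousMap ℝ ℝ, ExpIntegrable fun s => F (r (-s)) := fun r =>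
    .of_bounded ((hcF r).comp continuous_neg) fun s => hbd r (-s)
  have hR2 : ExpIntegrable fun s => b (-s) := .of_integrable (hbc.comp continuous_neg) hbn
  have hR : ∀ r, ExpIntegrable (fun s => f r (-s)) := fun r => (hR1 r).add hR2
  have tL : ∀ r, Tendsto (expLeft (f r)) (cocompact ℝ) (𝓝 0) := fun r => by
    have := (tendsto_expLeft_of_tendsto (hcF r) (hbd r) (htF r)).add
      (tendsto_expLeft_of_integrable hb)
    rw [add_zero] at this
    exact this.congr fun s => (expLeft_add (hL1 r) hL2 s).symm
  have tR : ∀ r, Tendsto (expRight (f r)) (cocompact ℝ) (𝓝 0) := fun r => by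
    have := (tendsto_expLeft_of_tendsto ((hcF r).comp continuous_neg) (fun s => hbd r (-s))
      ((htF r).comp tendsto_neg_cocompact_real)).add (tendsto_expLeft_of_integrable hbn)
    rw [add_zero] at this
    exact (this.congr fun s => (expLeft_add (hR1 r) hR2 s).symm).comp tendsto_neg_cocompact_real
  -- With `R' = R - f` and `L' = -L + f`, the average `u = (R + L) / 2` has `u' = (R - L) / 2` and
  -- `u'' = u - f`.
  let u : ZeroAtInftyContinuousMap ℝ ℝ → ℝ → ℝ := fun r s =>
    (expRight (f r) s + expLeft (f r) s) / 2
  let u₁ : ZeroAtInftyContinuousMap ℝ ℝ → ℝ → ℝ := fun r s =>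
    (expRight (f r) s - expLeft (f r) s) / 2
  have hu : ∀ r s, HasDerivAt (u r) (u₁ r s) s := fun r s => by
    have := ((hasDerivAt_expRight (hR r) s).add ((hL r).hasDerivAt s)).div_const 2
    exact this.congr_deriv (by simp only [u₁]; ring)
  have hu₁ : ∀ r s, HasDerivAt (u₁ r) (u r s - F (r s) - b s) s := fun r s => by
    have := ((hasDerivAt_expRight (hR r) s).sub ((hL r).hasDerivAt s)).div_const 2
    exact this.congr_deriv (by simp only [u, f]; ring)
  have tu : ∀ r, Tendsto (u r) (cocompact ℝ) (𝓝 0) := fun r => by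
    have := ((tR r).add (tL r)).div_const 2
    rwa [add_zero, zero_div] at this
  have tu₁ : ∀ r, Tendsto (u₁ r) (cocompact ℝ) (𝓝 0) := fun r => by
    have := ((tR r).sub (tL r)).div_const 2
    rwa [sub_zero, zero_div] at this
  have hmean : ∀ {a a' c c' C : ℝ}, |a - a'| ≤ C → |c - c'| ≤ C →
      |(a + c) / 2 - (a' + c') / 2| ≤ C := by
    intro a a' c c' C h1 h2
    rw [abs_le] at *
    constructor <;> linarith
  let T : ZeroAtInftyContinuousMap ℝ ℝ → ZeroAtInftyContinuousMap ℝ ℝ := fun r =>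
    ⟨⟨u r, continuous_iff_continuousAt.2 fun s => (hu r s).continuousAt⟩, tu r⟩
  have hTu : ∀ r s, T r s = u r s := fun r s => rfl
  have hT : ContractingWith K T := by
    refine ⟨hK, LipschitzWith.of_dist_le_mul fun r q => ?_⟩
    have hd : ∀ s, |f r s - f q s| ≤ K * dist r q := fun s => by
      have h1 := hF.dist_le_mul (r s) (q s)
      rw [Real.dist_eq] at h1
      simp only [f, add_sub_add_right_eq_sub]
      refine h1.trans (mul_le_mul_of_nonneg_left ?_ K.2)
      rw [← ZeroAtInftyContinuousMap.dist_toBCF_eq_dist]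
      exact BoundedContinuousFunction.dist_coe_le_dist (f := r.toBCF) (g := q.toBCF) s
    rw [← ZeroAtInftyContinuousMap.dist_toBCF_eq_dist]
    refine (BoundedContinuousFunction.dist_le (mul_nonneg K.2 dist_nonneg)).2 fun s => ?_
    change dist (u r s) (u q s) ≤ _
    rw [Real.dist_eq]
    exact hmean (abs_expLeft_sub_le (hR r) (hR q) (fun s => hd (-s)) (-s))
      (abs_expLeft_sub_le (hL r) (hL q) hd s)
  have : Nonempty (ZeroAtInftyContinuousMap ℝ ℝ) := ⟨0⟩
  set r := hT.fixedPoint T with hrdef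
  have hfix : T r = r := hT.fixedPoint_isFixedPt
  have hur : u r = r := funext fun s => by rw [← hTu, hfix]
  refine ⟨r, u₁ r, fun s => hur ▸ hu r s, fun s => ?_, r.zero_at_infty', tu₁ r⟩
  have := hu₁ r s
  rwa [hur] at this

/-- The nonlinearity `x - 1 + e^{-x}`, frozen outside `[0, M]`. -/
noncomputable def truncatedNonlinearity (M x : ℝ) : ℝ :=
  max 0 (min M x) - 1 + Real.exp (-max 0 (min M x))

theorem truncatedNonlinearity_zero {M : ℝ} (hM : 0 ≤ M) : truncatedNonlinearity M 0 = 0 := by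
  simp [truncatedNonlinearity, hM]

theorem lipschitzWith_truncatedNonlinearity {M : ℝ} (hM : 0 ≤ M) :
    LipschitzWith (1 - Real.exp (-M)).toNNReal (truncatedNonlinearity M) := by
  have hE : 0 ≤ 1 - Real.exp (-M) := sub_nonneg.2 (Real.exp_le_one_iff.2 (by linarith))
  -- Mean value bounds for `e^{-x}` on `[0, M]`, whose slope lies between `-1` and `-e^{-M}`, drawn
  -- from `1 + z ≤ e^z`.
  have key : ∀ x y : ℝ, 0 ≤ x → x ≤ y → y ≤ M →
      |(y - 1 + Real.exp (-y)) - (x - 1 + Real.exp (-x))| ≤ (1 - Real.exp (-M)) * (y - x) := by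
    intro x y hx hxy hy
    have e1 : Real.exp (-x) = Real.exp (-y) * Real.exp (y - x) := by
      rw [← Real.exp_add]; congr 1; ring
    have e2 : Real.exp (-y) = Real.exp (-x) * Real.exp (-(y - x)) := by
      rw [← Real.exp_add]; congr 1; ring
    have h1 : Real.exp (-M) * (y - x) ≤ Real.exp (-x) - Real.exp (-y) := by
      have h2 := Real.add_one_le_exp (y - x)
      have h3 : Real.exp (-M) ≤ Real.exp (-y) := Real.exp_le_exp.2 (by linarith)
      have h4 := mul_le_mul h3 (by linarith : y - x ≤ Real.exp (y - x) - 1) (by linarith)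
        (Real.exp_pos _).le
      rw [e1]; linarith
    have h5 : Real.exp (-x) - Real.exp (-y) ≤ y - x := by
      have h6 := Real.add_one_le_exp (-(y - x))
      have h7 : Real.exp (-x) ≤ 1 := Real.exp_le_one_iff.2 (by linarith)
      have h8 : 1 - Real.exp (-(y - x)) ≤ y - x := by linarith
      have h9 : 0 ≤ 1 - Real.exp (-(y - x)) :=
        sub_nonneg.2 (Real.exp_le_one_iff.2 (by linarith))
      have := mul_le_of_le_one_left h9 h7
      rw [e2]; linarith
    rw [abs_of_nonneg (by linarith)]
    linarith
  refine LipschitzWith.of_dist_le_mul fun x y => ?_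
  wlog hxy : x ≤ y generalizing x y
  · rw [dist_comm, dist_comm x]; exact this y x (le_of_not_ge hxy)
  have hm : max 0 (min M x) ≤ max 0 (min M y) := max_le_max le_rfl (min_le_min le_rfl hxy)
  have hd : max 0 (min M y) - max 0 (min M x) ≤ y - x := by
    have h1 := abs_max_sub_max_le_abs (min M y) (min M x) 0
    have h2 := abs_min_sub_min_le_max M y M x
    rw [sub_self, abs_zero, max_eq_right (abs_nonneg _), abs_of_nonneg (sub_nonneg.2 hxy)] at h2
    rw [max_comm _ 0, max_comm _ 0] at h1
    exact (le_abs_self _).trans (h1.trans h2)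
  rw [dist_comm, dist_comm x, Real.dist_eq, Real.dist_eq, Real.coe_toNNReal _ hE,
    abs_of_nonneg (sub_nonneg.2 hxy)]
  exact (key _ _ (le_max_left _ _) hm (max_le hM (min_le_left _ _))).trans
    (mul_le_mul_of_nonneg_left hd hE)

theorem exists_classical_solution {b : ℝ → ℝ} (hbc : Continuous b) (hb0 : ∀ s, 0 ≤ b s)
    (hb : Integrable b volume) :
    ∃ r r₁ : ℝ → ℝ, (∀ s, HasDerivAt r (r₁ s) s) ∧
      (∀ s, HasDerivAt r₁ (1 - Real.exp (-(r s)) - b s) s) ∧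
      Tendsto r (cocompact ℝ) (𝓝 0) ∧ Tendsto r₁ (cocompact ℝ) (𝓝 0) := by
  -- Truncating exactly at the a priori bound makes the truncation inactive on the solution.
  set M := max (2 * Real.log 2) (4 * (∫ σ, b σ) ^ 2) with hMdef
  have hlog : 0 < Real.log 2 := Real.log_pos (by norm_num)
  have hM2 : 2 * Real.log 2 ≤ M := le_max_left _ _
  have hM : 0 ≤ M := by linarith
  have hlip := lipschitzWith_truncatedNonlinearity hM
  obtain ⟨r, r₁, hr, hr₁, hr0, hr₁0⟩ := exists_solution_of_lipschitz hbc hb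
    (K := (1 - Real.exp (-M)).toNNReal)
    (by rw [← NNReal.coe_lt_coe, Real.coe_toNNReal _
          (sub_nonneg.2 (Real.exp_le_one_iff.2 (by linarith)))]
        have := Real.exp_pos (-M)
        simp only [NNReal.coe_one]; linarith)
    hlip (truncatedNonlinearity_zero hM)
  have hc : Continuous r := continuous_iff_continuousAt.2 fun s => (hr s).continuousAt
  have hnn : ∀ s, 0 ≤ r s := nonneg_of_tendsto_cocompact_of_deriv2_neg hr hr₁ hr0 fun s hs => by
    have : truncatedNonlinearity M (r s) = 0 := by
      rw [truncatedNonlinearity, min_eq_right (by linarith), max_eq_left hs.le]; simp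
    rw [this]; linarith [hb0 s]
  -- Freezing `F` above `M` only increases `r - F(r)` beyond its value at `M`, so the hypotheses on
  -- `h` survive; `M ≥ log 2` gives the threshold.
  have hlow : ∀ s, 1 - Real.exp (-min M (r s)) ≤ r s - truncatedNonlinearity M (r s) := by
    intro s
    rw [truncatedNonlinearity, max_eq_right (le_min hM (hnn s))]
    linarith [min_le_right M (r s)]
  have hle : ∀ s, r s ≤ M := le_max_of_hasDerivAt_of_le_half
    (h := fun s => r s - truncatedNonlinearity M (r s)) hr hr₁ hr0 hnn
    (hc.sub (hlip.continuous.comp hc)) hbc hb0 hb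
    (fun s => by
      have h1 := hlow s
      have h2 : Real.exp (-min M (r s)) ≤ 1 :=
        Real.exp_le_one_iff.2 (by linarith [le_min hM (hnn s)])
      linarith)
    (fun s hs => by
      have h1 := hlow s
      have h2 : Real.exp (-min M (r s)) ≤ Real.exp (-Real.log 2) :=
        Real.exp_le_exp.2 (neg_le_neg (le_min (by linarith) hs))
      rw [Real.exp_neg (Real.log 2), Real.exp_log (by norm_num)] at h2
      linarith)
  refine ⟨r, r₁, hr, fun s => ?_, hr0, hr₁0⟩
  have e : r s - truncatedNonlinearity M (r s) = 1 - Real.exp (-(r s)) := by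
    rw [truncatedNonlinearity, min_eq_right (hle s), max_eq_right (hnn s)]; ring
  rw [← e]
  exact hr₁ s

/-! ### Square integrability of the classical solution -/

theorem exists_abs_le_of_tendsto_cocompact {f : ℝ → ℝ} (hf : Continuous f)
    (h0 : Tendsto f (cocompact ℝ) (𝓝 0)) : ∃ C, 0 ≤ C ∧ ∀ s, |f s| ≤ C := by
  let g : ZeroAtInftyContinuousMap ℝ ℝ := ⟨⟨f, hf⟩, h0⟩
  exact ⟨‖g‖, norm_nonneg _, fun s => g.toBCF.norm_coe_le_norm s⟩

theorem integrable_of_intervalIntegral_le {f : ℝ → ℝ} (hf : Continuous f) (hf0 : ∀ s, 0 ≤ f s)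
    (I : ℝ) (h : ∀ n : ℕ, ∫ s in (-(n:ℝ))..n, f s ≤ I) : Integrable f volume := by
  refine integrable_of_intervalIntegral_norm_bounded (l := atTop) (a := fun n : ℕ => -(n:ℝ))
    (b := fun n : ℕ => (n:ℝ)) I (fun n => hf.integrableOn_Ioc)
    (tendsto_neg_atTop_atBot.comp tendsto_natCast_atTop_atTop) tendsto_natCast_atTop_atTop
    (Eventually.of_forall fun n => ?_)
  simpa only [Real.norm_eq_abs, abs_of_nonneg (hf0 _)] using h n

theorem classical_solution_memLp {b r r₁ : ℝ → ℝ} (hbc : Continuous b) (hb0 : ∀ s, 0 ≤ b s)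
    (hb : Integrable b volume) (hb2 : MemLp b 2 volume) (hr : ∀ s, HasDerivAt r (r₁ s) s)
    (hr₁ : ∀ s, HasDerivAt r₁ (1 - Real.exp (-(r s)) - b s) s)
    (hr0 : Tendsto r (cocompact ℝ) (𝓝 0)) (hr₁0 : Tendsto r₁ (cocompact ℝ) (𝓝 0)) :
    MemLp r 2 volume ∧ MemLp r₁ 2 volume ∧
      MemLp (fun s => 1 - Real.exp (-(r s)) - b s) 2 volume := by
  have hnn : ∀ s, 0 ≤ r s := fun s => (classical_solution_bounds hbc hb0 hb hr hr₁ hr0 s).1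
  have hc : Continuous r := continuous_iff_continuousAt.2 fun s => (hr s).continuousAt
  have hc₁ : Continuous r₁ := continuous_iff_continuousAt.2 fun s => (hr₁ s).continuousAt
  obtain ⟨M, hM0, hM⟩ := exists_abs_le_of_tendsto_cocompact hc hr0
  obtain ⟨C, hC0, hC⟩ := exists_abs_le_of_tendsto_cocompact hc₁ hr₁0
  have hle : ∀ s, r s ≤ M := fun s => (le_abs_self _).trans (hM s)
  set h : ℝ → ℝ := fun s => 1 - Real.exp (-(r s)) with hh
  have hhc : Continuous h := by fun_prop
  have hh0 : ∀ s, 0 ≤ h s := fun s => sub_nonneg.2 (Real.exp_le_one_iff.2 (by linarith [hnn s]))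
  have hhr : ∀ s, h s ≤ r s := fun s => by
    have := Real.add_one_le_exp (-(r s))
    simp only [hh]; linarith
  have hnle : ∀ n : ℕ, -(n:ℝ) ≤ n := fun n => by
    have : (0:ℝ) ≤ n := n.cast_nonneg
    linarith
  -- Integrating the equation over `[-n, n]` bounds `∫ h` by the boundary slopes plus `‖b‖₁`.
  have hhi : Integrable h volume := by
    refine integrable_of_intervalIntegral_le hhc hh0 (2 * C + ∫ s, b s) fun n => ?_
    have e := intervalIntegral.integral_eq_sub_of_hasDerivAt (a := -(n:ℝ)) (b := n)
      (fun x _ => hr₁ x) ((hhc.sub hbc).intervalIntegrable _ _)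
    rw [intervalIntegral.integral_sub (hhc.intervalIntegrable _ _)
      (hbc.intervalIntegrable _ _)] at e
    have h1 := intervalIntegral_le_integral hb0 hb (hnle n)
    have h2 := abs_le.1 (hC n)
    have h3 := abs_le.1 (hC (-n))
    linarith [h2.2, h3.1]
  -- From `r ≤ e^r - 1 = e^r h`, integrability passes from `h` to `r`.
  have hrle : ∀ s, r s ≤ Real.exp M * h s := fun s => by
    have h1 := Real.add_one_le_exp (r s)
    have h2 : Real.exp (r s) * h s = Real.exp (r s) - 1 := by
      simp only [hh, mul_sub, ← Real.exp_add]; simp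
    have h3 : Real.exp (r s) * h s ≤ Real.exp M * h s :=
      mul_le_mul_of_nonneg_right (Real.exp_le_exp.2 (hle s)) (hh0 s)
    linarith
  have hri : Integrable r volume := (hhi.const_mul (Real.exp M)).mono' hc.aestronglyMeasurable
    (Eventually.of_forall fun s => by
      rw [Real.norm_eq_abs, abs_of_nonneg (hnn s)]; exact hrle s)
  have hr2 : MemLp r 2 volume := by
    rw [memLp_two_iff_integrable_sq hc.aestronglyMeasurable]
    refine (hri.const_mul M).mono' (by fun_prop) (Eventually.of_forall fun s => ?_)
    rw [Real.norm_eq_abs, abs_of_nonneg (sq_nonneg _), sq]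
    exact mul_le_mul_of_nonneg_right (hle s) (hnn s)
  have hh2 : MemLp h 2 volume := hr2.mono hhc.aestronglyMeasurable
    (Eventually.of_forall fun s => by
      rw [Real.norm_eq_abs, Real.norm_eq_abs, abs_of_nonneg (hh0 s), abs_of_nonneg (hnn s)]
      exact hhr s)
  refine ⟨hr2, ?_, hh2.sub hb2⟩
  rw [memLp_two_iff_integrable_sq hc₁.aestronglyMeasurable]
  refine integrable_of_intervalIntegral_le (by fun_prop) (fun s => sq_nonneg _)
    (2 * (M * C) + M * ∫ s, b s) fun n => ?_
  -- Energy estimate: `∫ r₁² = [r r₁] - ∫ r (h - b)`, where `r h ≥ 0` and `r b ≤ M b`.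
  have e := intervalIntegral.integral_mul_deriv_eq_deriv_mul (a := -(n:ℝ)) (b := n)
    (fun x _ => hr x) (fun x _ => hr₁ x) (hc₁.intervalIntegrable _ _)
    ((hhc.sub hbc).intervalIntegrable _ _)
  have e2 : ∫ s in (-(n:ℝ))..n, r₁ s ^ 2 = ∫ s in (-(n:ℝ))..n, r₁ s * r₁ s := by
    simp only [sq]
  have h1 : ∫ s in (-(n:ℝ))..n, -(M * b s) ≤ ∫ s in (-(n:ℝ))..n, r s * (h s - b s) := by
    refine intervalIntegral.integral_mono_on (hnle n)
      (Continuous.intervalIntegrable (by fun_prop) _ _)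
      (Continuous.intervalIntegrable (by fun_prop) _ _) fun s _ => ?_
    have h2 := mul_nonneg (hnn s) (hh0 s)
    have h3 := mul_le_mul_of_nonneg_right (hle s) (hb0 s)
    linarith
  rw [intervalIntegral.integral_neg, intervalIntegral.integral_const_mul] at h1
  have h4 := mul_le_mul_of_nonneg_left (intervalIntegral_le_integral hb0 hb (hnle n)) hM0
  have h5 : ∀ s, |r s * r₁ s| ≤ M * C := fun s => by
    rw [abs_mul]; exact mul_le_mul (hM s) (hC s) (abs_nonneg _) hM0
  have h6 := abs_le.1 (h5 n)
  have h7 := abs_le.1 (h5 (-n))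
  rw [e2]
  simp only [hh] at h1
  linarith [h6.2, h7.1]

/-! ### The main theorem -/

theorem mainTheorem2 (b : ℝ → ℝ) (hb_smooth : ContDiff ℝ ∞ b) (hb_nonneg : ∀ s, 0 ≤ b s)
    (hb_L1 : Integrable b volume) (hb_L2 : MemLp b 2 volume) :
    (∃! ρ : Lp ℝ 2 (volume : Measure ℝ), ρ ∈ SobolevW22 ∧ SolvesKazdanWarner b ρ) ∧
    ∀ ρ : Lp ℝ 2 (volume : Measure ℝ), ρ ∈ SobolevW22 → SolvesKazdanWarner b ρ →
      ∃ r : ℝ → ℝ, Continuous r ∧ (∀ᵐ s, ρ s = r s) ∧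
        ∀ s, 0 ≤ r s ∧ r s ≤ max (2 * Real.log 2) (4 * (∫ σ, b σ) ^ 2) := by
  have hbc : Continuous b := hb_smooth.continuous
  refine ⟨existsUnique_of_exists_of_unique ?_ ?_, ?_⟩
  · obtain ⟨r, r₁, hr, hr₁, hr0, hr₁0⟩ := exists_classical_solution hbc hb_nonneg hb_L1
    have hc : Continuous r := continuous_iff_continuousAt.2 fun s => (hr s).continuousAt
    have hc₁ : Continuous r₁ := continuous_iff_continuousAt.2 fun s => (hr₁ s).continuousAt
    obtain ⟨m, m₁, m₂⟩ :=
      classical_solution_memLp hbc hb_nonneg hb_L1 hb_L2 hr hr₁ hr0 hr₁0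
    have w₁ : IsWeakDeriv (m.toLp r) (m₁.toLp r₁) :=
      (isWeakDeriv_of_hasDerivAt hr hc₁).congr_ae m.coeFn_toLp.symm m₁.coeFn_toLp.symm
    have w₂ := (isWeakDeriv_of_hasDerivAt hr₁ (by fun_prop)).congr_ae m₁.coeFn_toLp.symm
      m₂.coeFn_toLp.symm
    refine ⟨m.toLp r, ⟨m₁.toLp r₁, m₂.toLp _, w₁, w₂⟩, m₁.toLp r₁, m₂.toLp _, w₁, w₂, ?_⟩
    filter_upwards [m.coeFn_toLp, m₂.coeFn_toLp] with s h h₂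
    rw [h, h₂]
  · rintro ρ σ ⟨hρ, hρs⟩ ⟨hσ, hσs⟩
    obtain ⟨r, r₁, hae, hr, hr₁, hr0⟩ := hρs.exists_classical hbc hρ
    obtain ⟨q, q₁, hae', hq, hq₁, hq0⟩ := hσs.exists_classical hbc hσ
    obtain rfl := classical_solution_unique hr hr₁ hr0 hq hq₁ hq0
    refine Lp.ext ?_
    filter_upwards [hae, hae'] with s h h'
    rw [h, h']
  · intro ρ hρ hρs
    obtain ⟨r, r₁, hae, hr, hr₁, hr0⟩ := hρs.exists_classical hbc hρ
    exact ⟨r, continuous_iff_continuousAt.2 fun s => (hr s).continuousAt, hae,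
      classical_solution_bounds hbc hb_nonneg hb_L1 hr hr₁ hr0⟩
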